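/- Let $\mathcal H$ be a complex separable Hilbert space with an orthogonal decomposition $\mathcal H=\mathcal H_+\oplus\mathcal H_-$ into two infinite-dimensional closed subspaces, let $\mathrm{pr}_\pm$ be the orthogonal projections onto $\mathcal H_\pm$, and put $d=i(\mathrm{pr}_+-\mathrm{pr}_-)$. For $1\le p<\infty$ let $L_p$ be the Schatten class of bounded operators $A$ with $\mathrm{Tr}\,(A^*A)^{p/2}<\infty$, with $\|A\|_p=(\mathrm{Tr}\,(A^*A)^{p/2})^{1/p}$. Let $$L_{\mathrm{res},p}(\mathcal H)=\{A\in\mathcal B(\mathcal H)\mid [d,A]\in L_p(\mathcal H)\},\qquad \|A\|_{\mathrm{res},p}=\|A\|+\|[d,A]\|_p .$$ For $\rho\in\mathcal B(\mathcal H)$ write $\rho_{\pm\pm}=\mathrm{pr}_\pm\rho|_{\mathcal H_\pm}$ for its diagonal blocks, let $L_{1,q}(\mathcal H)$ be the set of $\rho\in\mathcal B(\mathcal H)$ with $[d,\rho]\in L_q(\mathcal H)$ and $\rho_{++},\rho_{--}$ trace class, and put $\mathrm{Tr_{res}}(\rho)=\mathrm{Tr}(\rho_{++})+\mathrm{Tr}(\rho_{--})$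 for $\rho\in L_{1,q}(\mathcal H)$. **Proposition.** Let $1<p\le 2$ and $\frac1p+\frac1q=1$. Then $L_{\mathrm{res},p}(\mathcal H)$ is a unital subalgebra of $\mathcal B(\mathcal H)$, hence a Lie algebra under the commutator, and the Schwinger term $$s(A,B)=\mathrm{Tr_{res}}(A[d,B]),\qquad A,B\in L_{\mathrm{res},p}(\mathcal H),$$ is a continuous complex-valued 2-cocycle on it. That is: 1. $s$ is well defined: $A[d,B]\in L_{1,q}(\mathcal H)$ for all $A,B\in L_{\mathrm{res},p}(\mathcal H)$, and the traces of the two diagonal blocks of $A[d,B]$ are the sums of the diagonal matrix coefficients in any Hilbert basis of $\mathcal H_+$, respectively $\mathcal H_-$; 2. $s$ is complex bilinear and skew-symmetric, $s(A,B)=-s(B,A)$; 3. $s([A,B],C)+s([C,A],B)+s([B,C],A)=0$ for all $A,B,C\in L_{\mathrm{res},p}(\mathcal H)$; 4. $s$ is jointly continuous on $L_{\mathrm{res},p}(\mathcal H)\times L_{\mathrm{res},p}(\mathcal H)$ with respect to $\|\cdot\|_{\mathrm{res},p}$; 5. $|s(A,B)|\le 2\,\|A\|_{\mathrm{res},p}\,\|B\|_{\mathrm{res},p}$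 for all $A,B\in L_{\mathrm{res},p}(\mathcal H)$. -/

import Mathlib

open scoped ENNReal InnerProductSpace

noncomputable section

namespace RestrictedSchatten

/-- The matrix coefficients `⟪eᵢ, T eᵢ⟫` of an operator summed over a Hilbert basis `e` of the space
(the sum does not depend on the basis when `T` is trace class). -/
def trace {E : Type*} [NormedAddCommGroup E] [InnerProductSpace ℂ E] [CompleteSpace E]
    (T : E →L[ℂ] E) : ℂ :=
  ∑' i, ⟪(exists_hilbertBasis ℂ E).choose_spec.choose i,
    T ((exists_hilbertBasis ℂ E).choose_spec.choose i)⟫_ℂ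

/-- The trace, in `[0, ∞]`, of a nonnegative operator. -/
def positiveTrace {E : Type*} [NormedAddCommGroup E] [InnerProductSpace ℂ E] [CompleteSpace E]
    (T : E →L[ℂ] E) : ℝ≥0∞ :=
  ∑' i, ENNReal.ofReal (⟪(exists_hilbertBasis ℂ E).choose_spec.choose i,
    T ((exists_hilbertBasis ℂ E).choose_spec.choose i)⟫_ℂ).re

/-- `Tr (A⋆ A)^(p/2)`, with the power given by the continuous functional calculus. -/
def schattenTrace {E F : Type*} [NormedAddCommGroup E] [InnerProductSpace ℂ E] [CompleteSpace E]
    [NormedAddCommGroup F] [InnerProductSpace ℂ F] [CompleteSpace F]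
    (p : ℝ) (A : E →L[ℂ] F) : ℝ≥0∞ :=
  positiveTrace ((ContinuousLinearMap.adjoint A ∘L A) ^ (p / 2))

/-- Membership in the Schatten class `L_p(E, F)`, for a real exponent `p ≥ 1`. -/
def MemSchatten {E F : Type*} [NormedAddCommGroup E] [InnerProductSpace ℂ E] [CompleteSpace E]
    [NormedAddCommGroup F] [InnerProductSpace ℂ F] [CompleteSpace F]
    (p : ℝ) (A : E →L[ℂ] F) : Prop :=
  schattenTrace p A < ∞

/-- The Schatten norm `‖A‖_p = (Tr (A⋆ A)^(p/2))^(1/p)` of an operator of class `L_p`. -/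
def schattenNorm {E F : Type*} [NormedAddCommGroup E] [InnerProductSpace ℂ E] [CompleteSpace E]
    [NormedAddCommGroup F] [InnerProductSpace ℂ F] [CompleteSpace F]
    (p : ℝ) (A : E →L[ℂ] F) : ℝ :=
  (schattenTrace p A).toReal ^ (1 / p)

section Polarized

/-! `H = Hp ⊕ Hpᗮ` is a polarized Hilbert space: `Hp` is the summand `H₊`, and `Hpᗮ` is `H₋`. -/

variable {H : Type*} [NormedAddCommGroup H] [InnerProductSpace ℂ H] [CompleteSpace H]
  (Hp : Submodule ℂ H) [CompleteSpace Hp]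

/-- `d = i (pr₊ - pr₋)`, as an operator on `H`. -/
def d : H →L[ℂ] H :=
  Complex.I • (Hp.starProjection - Hpᗮ.starProjection)

/-- The diagonal block `ρ₊₊ = pr₊ ρ|_{H₊}`. -/
def blockPlus (ρ : H →L[ℂ] H) : Hp →L[ℂ] Hp :=
  Hp.orthogonalProjectionOnto ∘L ρ ∘L Hp.subtypeL

/-- The diagonal block `ρ₋₋ = pr₋ ρ|_{H₋}`. -/
def blockMinus (ρ : H →L[ℂ] H) : Hpᗮ →L[ℂ] Hpᗮ :=
  Hpᗮ.orthogonalProjectionOnto ∘L ρ ∘L Hpᗮ.subtypeL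

/-- Membership in `L_{res,p}(H)`: the commutator `[d, A]` is of class `L_p`. -/
def MemRes (p : ℝ) (A : H →L[ℂ] H) : Prop :=
  MemSchatten p ⁅d Hp, A⁆

/-- `‖A‖_{res,p} = ‖A‖ + ‖[d, A]‖_p`. -/
def resNorm (p : ℝ) (A : H →L[ℂ] H) : ℝ :=
  ‖A‖ + schattenNorm p ⁅d Hp, A⁆

/-- Membership in `L_{1,q}(H)`: `[d, ρ]` is of class `L_q` and the diagonal blocks of `ρ` are
trace class. -/
def MemOneQ (q : ℝ) (ρ : H →L[ℂ] H) : Prop :=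
  MemSchatten q ⁅d Hp, ρ⁆ ∧ MemSchatten 1 (blockPlus Hp ρ) ∧ MemSchatten 1 (blockMinus Hp ρ)

/-- The restricted trace `Tr_res ρ = Tr ρ₊₊ + Tr ρ₋₋`. -/
def resTrace (ρ : H →L[ℂ] H) : ℂ :=
  trace (blockPlus Hp ρ) + trace (blockMinus Hp ρ)

/-- The Schwinger term `s(A, B) = Tr_res (A [d, B])`. -/
def schwinger (A B : H →L[ℂ] H) : ℂ :=
  resTrace Hp (A * ⁅d Hp, B⁆)

end Polarized

/-- A continuous complex-valued two-cocycle on the Lie algebra of a complex associative algebra `𝔤`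
under the commutator, normed by `N`: a bilinear skew-symmetric map that satisfies the cocycle
identity and is jointly continuous for the distance `N (A' - A)`. -/
structure IsContinuousTwoCocycle {𝔤 : Type*} [Ring 𝔤] [Algebra ℂ 𝔤]
    (N : 𝔤 → ℝ) (Φ : 𝔤 → 𝔤 → ℂ) : Prop where
  add_left : ∀ A A' B, Φ (A + A') B = Φ A B + Φ A' B
  smul_left : ∀ (c : ℂ) A B, Φ (c • A) B = c * Φ A B
  add_right : ∀ A B B', Φ A (B + B') = Φ A B + Φ A B'
  smul_right : ∀ (c : ℂ) A B, Φ A (c • B) = c * Φ A B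
  skew : ∀ A B, Φ A B = -Φ B A
  cocycle : ∀ A B C, Φ ⁅A, B⁆ C + Φ ⁅C, A⁆ B + Φ ⁅B, C⁆ A = 0
  continuous : ∀ A B, ∀ ε > 0, ∃ δ > 0, ∀ A' B', N (A' - A) < δ → N (B' - B) < δ →
    ‖Φ A' B' - Φ A B‖ < ε

end RestrictedSchatten

end

noncomputable section

set_option linter.unusedSectionVars false

/-! Since `p ≤ 2`, the class `L_p` lies in the Hilbert–Schmidt class, with `‖·‖_2 ≤ ‖·‖_p`, so all
traces reduce to products of two Hilbert–Schmidt operators. As `d² = -1`, each `[d, A]` anticommutes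
with `d`. Subtracting `offDiag A = -(1/2) d [d, A]` from `A` leaves an operator commuting with `d`;
its product with `[d, B]` anticommutes with `d`, hence has zero diagonal blocks. The diagonal blocks
of `A [d, B]` are therefore compressions of `offDiag A · [d, B]`, which are trace class, and
`schwinger_eq` gives `s(A, B) = -(1/2) Tr(d [d, A] [d, B])`.

From this formula, cyclicity (`trace_comp_comm`) and anticommutation give skew-symmetry and the
cocycle identity, and Cauchy–Schwarz gives the bound, hence continuity.

Two analytic facts remain. `L_p` is a two-sided ideal: this rests on operator monotonicity of `t ^
(p/2)`, on `positiveTrace_add_rpow_le` for sums and on unitaries spanning the algebra. And a product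
of Hilbert–Schmidt operators is trace class (`memSchatten_one_comp`). Inverse powers are regularized
by adding `ε > 0`. -/

namespace RestrictedSchatten

open ContinuousLinearMap

section HilbertSchmidt

variable {E F G : Type*} [NormedAddCommGroup E] [InnerProductSpace ℂ E] [CompleteSpace E]
  [NormedAddCommGroup F] [InnerProductSpace ℂ F] [CompleteSpace F]
  [NormedAddCommGroup G] [InnerProductSpace ℂ G] [CompleteSpace G]

/-! ### Hilbert–Schmidt operators -/

variable (E) in
/-- The Hilbert basis used in the definition of the trace. -/
abbrev stdBasis : HilbertBasis (exists_hilbertBasis ℂ E).choose ℂ E :=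
  (exists_hilbertBasis ℂ E).choose_spec.choose

/-- The square of the Hilbert–Schmidt norm, in `[0, ∞]`. -/
def hsSq (A : E →L[ℂ] F) : ℝ≥0∞ :=
  ∑' i, ‖A (stdBasis E i)‖ₑ ^ 2

/-- Hilbert–Schmidt operators. -/
def IsHS (A : E →L[ℂ] F) : Prop :=
  hsSq A ≠ ∞

lemma hasSum_norm_inner_sq {ι : Type*} (b : HilbertBasis ι ℂ E) (x : E) :
    HasSum (fun i => ‖⟪b i, x⟫_ℂ‖ ^ 2) (‖x‖ ^ 2) := by
  have h := Complex.hasSum_re (b.hasSum_inner_mul_inner x x)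
  have h1 : ∀ i, (⟪x, b i⟫_ℂ * ⟪b i, x⟫_ℂ).re = ‖⟪b i, x⟫_ℂ‖ ^ 2 := fun i => by
    rw [← inner_conj_symm x (b i), Complex.conj_mul', ← Complex.ofReal_pow, Complex.ofReal_re]
  simp only [h1] at h
  rwa [show (⟪x, x⟫_ℂ).re = ‖x‖ ^ 2 from (norm_sq_eq_re_inner (𝕜 := ℂ) x).symm] at h

lemma enorm_sq_eq_ofReal {V : Type*} [NormedAddCommGroup V] (x : V) :
    ‖x‖ₑ ^ 2 = ENNReal.ofReal (‖x‖ ^ 2) := by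
  rw [ENNReal.ofReal_pow (norm_nonneg x), ofReal_norm]

lemma enorm_sq_eq_tsum {ι : Type*} (b : HilbertBasis ι ℂ E) (x : E) :
    ‖x‖ₑ ^ 2 = ∑' i, ‖⟪b i, x⟫_ℂ‖ₑ ^ 2 := by
  have h := hasSum_norm_inner_sq b x
  rw [enorm_sq_eq_ofReal, ← h.tsum_eq, ENNReal.ofReal_tsum_of_nonneg (fun i => by positivity)
    h.summable]
  simp only [enorm_sq_eq_ofReal]

/-- Parseval in both bases, then Tonelli. Working in `[0, ∞]` removes any finiteness assumption;
basis independence of `hsSq` follows by applying this twice. -/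
lemma tsum_enorm_sq_adjoint {ι κ : Type*} (b : HilbertBasis ι ℂ E) (f : HilbertBasis κ ℂ F)
    (A : E →L[ℂ] F) : ∑' i, ‖A (b i)‖ₑ ^ 2 = ∑' j, ‖adjoint A (f j)‖ₑ ^ 2 := by
  simp_rw [enorm_sq_eq_tsum f (A _), enorm_sq_eq_tsum b (adjoint A _)]
  rw [ENNReal.tsum_comm]
  refine tsum_congr fun j => tsum_congr fun i => ?_
  rw [adjoint_inner_right, ← inner_conj_symm (f j)]
  rw [← ofReal_norm, ← ofReal_norm, RCLike.norm_conj]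

lemma hsSq_eq_tsum {ι : Type*} (b : HilbertBasis ι ℂ E) (A : E →L[ℂ] F) :
    hsSq A = ∑' i, ‖A (b i)‖ₑ ^ 2 := by
  rw [hsSq, tsum_enorm_sq_adjoint _ (stdBasis F), ← tsum_enorm_sq_adjoint b]

lemma hsSq_adjoint (A : E →L[ℂ] F) : hsSq (adjoint A) = hsSq A :=
  (tsum_enorm_sq_adjoint (stdBasis E) (stdBasis F) A).symm

lemma hsSq_comp_le (B : F →L[ℂ] G) (A : E →L[ℂ] F) : hsSq (B ∘L A) ≤ ‖B‖ₑ ^ 2 * hsSq A := by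
  rw [hsSq, hsSq, ← ENNReal.tsum_mul_left]
  refine ENNReal.tsum_le_tsum fun i => ?_
  rw [← mul_pow]
  gcongr
  exact B.le_opENorm _

lemma hsSq_smul (c : ℂ) (A : E →L[ℂ] F) : hsSq (c • A) = ‖c‖ₑ ^ 2 * hsSq A := by
  rw [hsSq, hsSq, ← ENNReal.tsum_mul_left]
  exact tsum_congr fun i => by rw [smul_apply, enorm_smul, mul_pow]

lemma IsHS.adjoint {A : E →L[ℂ] F} (h : IsHS A) : IsHS (adjoint A) := by
  rwa [IsHS, hsSq_adjoint]

lemma IsHS.comp_left {A : E →L[ℂ] F} (h : IsHS A) (B : F →L[ℂ] G) : IsHS (B ∘L A) :=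
  ne_top_of_le_ne_top (ENNReal.mul_ne_top (by simp) h) (hsSq_comp_le B A)

lemma IsHS.comp_right {A : F →L[ℂ] G} (h : IsHS A) (B : E →L[ℂ] F) : IsHS (A ∘L B) := by
  have := (h.adjoint.comp_left (ContinuousLinearMap.adjoint B)).adjoint
  rwa [← adjoint_comp, adjoint_adjoint] at this

lemma IsHS.smul {A : E →L[ℂ] F} (h : IsHS A) (c : ℂ) : IsHS (c • A) := by
  rw [IsHS, hsSq_smul]
  exact ENNReal.mul_ne_top (by simp) h

lemma hsSq_add_le (A B : E →L[ℂ] F) : hsSq (A + B) ≤ 2 * hsSq A + 2 * hsSq B := by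
  simp only [hsSq]
  rw [← ENNReal.tsum_mul_left, ← ENNReal.tsum_mul_left, ← ENNReal.tsum_add]
  refine ENNReal.tsum_le_tsum fun i => ?_
  have h := parallelogram_law_with_norm ℂ (A (stdBasis E i)) (B (stdBasis E i))
  simp only [enorm_sq_eq_ofReal, add_apply]
  rw [← ENNReal.ofReal_ofNat 2, ← ENNReal.ofReal_mul (by norm_num),
    ← ENNReal.ofReal_mul (by norm_num), ← ENNReal.ofReal_add (by positivity) (by positivity)]
  refine ENNReal.ofReal_le_ofReal ?_
  nlinarith [mul_self_nonneg ‖A (stdBasis E i) - B (stdBasis E i)‖]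

lemma IsHS.add {A B : E →L[ℂ] F} (hA : IsHS A) (hB : IsHS B) : IsHS (A + B) :=
  ne_top_of_le_ne_top (ENNReal.add_ne_top.2 ⟨ENNReal.mul_ne_top (by simp) hA,
    ENNReal.mul_ne_top (by simp) hB⟩) (hsSq_add_le A B)

lemma IsHS.neg {A : E →L[ℂ] F} (hA : IsHS A) : IsHS (-A) := by
  simpa using hA.smul (-1)

lemma IsHS.sub {A B : E →L[ℂ] F} (hA : IsHS A) (hB : IsHS B) : IsHS (A - B) := by
  simpa [sub_eq_add_neg] using hA.add hB.neg

lemma IsHS.hasSum_norm_sq {ι : Type*} (b : HilbertBasis ι ℂ E) {A : E →L[ℂ] F} (h : IsHS A) :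
    HasSum (fun i => ‖A (b i)‖ ^ 2) (hsSq A).toReal := by
  have hs := hsSq_eq_tsum b A
  have h2 := ENNReal.hasSum_toReal (f := fun i => ‖A (b i)‖ₑ ^ 2) (by rw [← hs]; exact h)
  rw [← ENNReal.tsum_toReal_eq fun i => by simp, ← hs] at h2
  simpa [ENNReal.toReal_pow] using h2

/-- The Hilbert–Schmidt inner product, through the polarization identity. -/
def hsInner (A B : E →L[ℂ] F) : ℂ :=
  ((hsSq (A + B)).toReal - (hsSq (A - B)).toReal +
    ((hsSq (A - Complex.I • B)).toReal - (hsSq (A + Complex.I • B)).toReal) * Complex.I) / 4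

/-- Polarization expresses the sum through values of `hsSq` alone, so it is independent of the basis
because `hsSq` is. -/
lemma hasSum_hsInner {ι : Type*} (b : HilbertBasis ι ℂ E) {A B : E →L[ℂ] F} (hA : IsHS A)
    (hB : IsHS B) : HasSum (fun i => ⟪A (b i), B (b i)⟫_ℂ) (hsInner A B) := by
  have key : ∀ {T : E →L[ℂ] F}, IsHS T →
      HasSum (fun i => ((‖T (b i)‖ : ℂ)) ^ 2) ((hsSq T).toReal : ℂ) := fun hT => by
    exact_mod_cast Complex.hasSum_ofReal.2 (hT.hasSum_norm_sq b)
  have hIB := hB.smul Complex.I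
  have := (((key (hA.add hB)).sub (key (hA.sub hB))).add
    (((key (hA.sub hIB)).sub (key (hA.add hIB))).mul_right Complex.I)).div_const 4
  simp_rw [inner_eq_sum_norm_sq_div_four (𝕜 := ℂ)]
  exact this

/-- The four terms of the polarization match up to adjoints and unimodular scalars, which `hsSq`
ignores. This is the source of cyclicity of the trace. -/
lemma hsInner_adjoint (A B : E →L[ℂ] F) : hsInner (adjoint B) (adjoint A) = hsInner A B := by
  have h1 : hsSq (adjoint B + adjoint A) = hsSq (A + B) := by
    rw [← map_add, hsSq_adjoint, add_comm]
  have h2 : hsSq (adjoint B - adjoint A) = hsSq (A - B) := by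
    rw [← map_sub, hsSq_adjoint, ← neg_sub, ← neg_one_smul ℂ, hsSq_smul]
    simp
  have h3 : hsSq (adjoint B - Complex.I • adjoint A) = hsSq (A - Complex.I • B) := by
    rw [← hsSq_adjoint (A - _), map_sub, map_smulₛₗ,
      show adjoint B - Complex.I • adjoint A = -Complex.I •
        (adjoint A - (starRingEnd ℂ) Complex.I • adjoint B) by
          simp [smul_smul]; abel, hsSq_smul]
    simp [← ofReal_norm]
  have h4 : hsSq (adjoint B + Complex.I • adjoint A) = hsSq (A + Complex.I • B) := by
    rw [← hsSq_adjoint (A + _), map_add, map_smulₛₗ,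
      show adjoint B + Complex.I • adjoint A = Complex.I •
        (adjoint A + (starRingEnd ℂ) Complex.I • adjoint B) by
          simp [smul_add, smul_smul]; abel, hsSq_smul]
    simp [← ofReal_norm]
  rw [hsInner, hsInner, h1, h2, h3, h4]

/-! ### The trace of a product of two Hilbert–Schmidt operators -/

lemma trace_comp_eq_hsInner {X : F →L[ℂ] E} {Y : E →L[ℂ] F} (hX : IsHS X) (hY : IsHS Y) :
    trace (X ∘L Y) = hsInner (adjoint X) Y := by
  rw [← (hasSum_hsInner (stdBasis E) hX.adjoint hY).tsum_eq]
  exact tsum_congr fun i => by rw [adjoint_inner_left]; rfl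

lemma hasSum_trace_comp {ι : Type*} (b : HilbertBasis ι ℂ E) {X : F →L[ℂ] E} {Y : E →L[ℂ] F}
    (hX : IsHS X) (hY : IsHS Y) :
    HasSum (fun i => ⟪b i, (X ∘L Y) (b i)⟫_ℂ) (trace (X ∘L Y)) := by
  rw [trace_comp_eq_hsInner hX hY]
  simpa only [adjoint_inner_left, comp_apply] using hasSum_hsInner b hX.adjoint hY

lemma trace_comp_comm {X : F →L[ℂ] E} {Y : E →L[ℂ] F} (hX : IsHS X) (hY : IsHS Y) :
    trace (X ∘L Y) = trace (Y ∘L X) := by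
  rw [trace_comp_eq_hsInner hX hY, trace_comp_eq_hsInner hY hX, ← hsInner_adjoint,
    adjoint_adjoint]

lemma trace_smul (c : ℂ) (T : E →L[ℂ] E) : trace (c • T) = c * trace T := by
  rw [trace, trace, ← tsum_mul_left]
  exact tsum_congr fun i => by rw [smul_apply, inner_smul_right]

lemma norm_trace_comp_le {X : F →L[ℂ] E} {Y : E →L[ℂ] F} (hX : IsHS X) (hY : IsHS Y) :
    ‖trace (X ∘L Y)‖ ≤ √(hsSq X).toReal * √(hsSq Y).toReal := by
  have hX' := hX.adjoint.hasSum_norm_sq (stdBasis E)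
  have hY' := hY.hasSum_norm_sq (stdBasis E)
  rw [hsSq_adjoint] at hX'
  have key := Real.inner_le_Lp_mul_Lq_tsum_of_nonneg Real.HolderConjugate.two_two
    (f := fun i => ‖adjoint X (stdBasis E i)‖) (g := fun i => ‖Y (stdBasis E i)‖)
    (fun i => norm_nonneg _) (fun i => norm_nonneg _)
    (by simpa using hX'.summable) (by simpa using hY'.summable)
  simp only [Real.rpow_two, hX'.tsum_eq, hY'.tsum_eq, ← Real.sqrt_eq_rpow] at key
  refine le_trans ?_ key
  rw [trace_comp_eq_hsInner hX hY, ← (hasSum_hsInner (stdBasis E) hX.adjoint hY).tsum_eq]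
  exact tsum_of_norm_bounded (Real.summable_mul_of_Lp_Lq_of_nonneg Real.HolderConjugate.two_two
    (fun i => norm_nonneg _) (fun i => norm_nonneg _) (by simpa using hX'.summable)
    (by simpa using hY'.summable)).hasSum fun i => norm_inner_le_norm _ _

end HilbertSchmidt

/-! ### Operator inequalities for real powers -/

section CStar

open scoped NNReal

variable {𝒜 : Type*} [CStarAlgebra 𝒜] [PartialOrder 𝒜] [StarOrderedRing 𝒜]

lemma smul_rpow (k : ℝ≥0) {a : 𝒜} (_ha : 0 ≤ a) {r : ℝ} (hr : 0 ≤ r) :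
    (k • a) ^ r = k ^ r • a ^ r := by
  have hc : Continuous fun x : ℝ≥0 => x ^ r := NNReal.continuous_rpow_const hr
  rw [CFC.rpow_def, CFC.rpow_def, ← cfc_comp_smul k _ a (by fun_prop),
    ← cfc_smul _ _ _ (by fun_prop)]
  exact cfc_congr fun x _ => by simp [NNReal.mul_rpow]

/-- Scalar inequality on the spectrum, where `x ≤ ‖a‖`. It yields both the inclusions between
Schatten classes and the comparison with the Hilbert–Schmidt norm. -/
lemma rpow_le_smul_rpow {a : 𝒜} (_ha : 0 ≤ a) {r t : ℝ} (hr : 0 < r) (hrt : r ≤ t) :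
    a ^ t ≤ ‖a‖₊ ^ (t - r) • a ^ r := by
  have hc : Continuous fun x : ℝ≥0 => x ^ r := NNReal.continuous_rpow_const hr.le
  have hc' : Continuous fun x : ℝ≥0 => x ^ t := NNReal.continuous_rpow_const (hr.le.trans hrt)
  rw [CFC.rpow_def, CFC.rpow_def, ← cfc_smul _ _ _ (by fun_prop)]
  refine cfc_mono fun x hx => ?_
  have hx' : x ≤ ‖a‖₊ := by
    simpa using CStarAlgebra.le_nnnorm_of_mem_quasispectrum
      (a := a) (spectrum_subset_quasispectrum ℝ≥0 a hx)
  calc x ^ t = x ^ (t - r) * x ^ r := by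
        rw [← NNReal.rpow_add_of_nonneg _ (sub_nonneg.2 hrt) hr.le, sub_add_cancel]
    _ ≤ ‖a‖₊ ^ (t - r) * x ^ r := by
        gcongr

/-- The power `-t ∈ [0, 1]` is operator monotone, and inversion reverses the order. -/
lemma rpow_antitone {a b : 𝒜} (ha : IsStrictlyPositive a) (hab : a ≤ b) {t : ℝ} (ht : -1 ≤ t)
    (ht' : t ≤ 0) : b ^ t ≤ a ^ t := by
  rcases ht'.eq_or_lt with rfl | ht'
  · rw [CFC.rpow_zero a ha.nonneg, CFC.rpow_zero b (ha.nonneg.trans hab)]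
  have hb : IsStrictlyPositive b := ha.of_le hab
  have h := CFC.rpow_le_rpow (p := -t) ⟨by linarith, by linarith⟩ hab
  have h2 := CStarAlgebra.rpow_neg_one_le_rpow_neg_one h (ha.rpow _ _)
  rw [CFC.rpow_rpow a _ _ (by linarith) ha, CFC.rpow_rpow b _ _ (by linarith) hb] at h2
  simpa using h2

lemma algebraMap_isStrictlyPositive {ε : ℝ≥0} (hε : 0 < ε) :
    IsStrictlyPositive (algebraMap ℝ≥0 𝒜 ε) :=
  ⟨by rw [Algebra.algebraMap_eq_smul_one]; exact smul_nonneg zero_le zero_le_one,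
    (IsUnit.mk0 ε hε.ne').map _⟩

lemma add_algebraMap_isStrictlyPositive {a : 𝒜} (ha : 0 ≤ a) {ε : ℝ≥0} (hε : 0 < ε) :
    IsStrictlyPositive (a + algebraMap ℝ≥0 𝒜 ε) :=
  (algebraMap_isStrictlyPositive hε).nonneg_add ha

lemma add_algebraMap_rpow_le {a : 𝒜} (ha : 0 ≤ a) {ε : ℝ≥0} (hε : 0 < ε) {t : ℝ} (ht : -1 ≤ t)
    (ht' : t ≤ 0) : (a + algebraMap ℝ≥0 𝒜 ε) ^ t ≤ algebraMap ℝ≥0 𝒜 (ε ^ t) := by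
  rw [← CFC.rpow_algebraMap]
  exact rpow_antitone (algebraMap_isStrictlyPositive hε) (le_add_of_nonneg_left ha) ht ht'

omit [PartialOrder 𝒜] [StarOrderedRing 𝒜] in
lemma smul_algebraMap_rpow_sub_one {ε : ℝ≥0} (hε : 0 < ε) (r : ℝ) :
    ε • algebraMap ℝ≥0 𝒜 (ε ^ (r - 1)) = algebraMap ℝ≥0 𝒜 (ε ^ r) := by
  rw [Algebra.smul_def, ← map_mul, NNReal.rpow_sub_one hε.ne', mul_div_cancel₀ _ hε.ne']

/-- Replaces `a ^ r = a ^ ((r-1)/2) * a * a ^ ((r-1)/2)`, which needs `a` invertible; the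
regularization costs at most `ε ^ r`. -/
lemma rpow_le_conjugate_add {a : 𝒜} (ha : 0 ≤ a) {ε : ℝ≥0} (hε : 0 < ε) {r : ℝ} (hr : 0 ≤ r)
    (hr' : r ≤ 1) :
    a ^ r ≤ (a + algebraMap ℝ≥0 𝒜 ε) ^ ((r - 1) / 2) * a *
      (a + algebraMap ℝ≥0 𝒜 ε) ^ ((r - 1) / 2) + algebraMap ℝ≥0 𝒜 (ε ^ r) := by
  have hpos := add_algebraMap_isStrictlyPositive ha hε
  set x := a + algebraMap ℝ≥0 𝒜 ε with hx
  have h1 : a ^ r ≤ x ^ r :=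
    CFC.rpow_le_rpow ⟨hr, hr'⟩ (le_add_of_nonneg_right (algebraMap_isStrictlyPositive hε).nonneg)
  have h2 : x ^ r = x ^ ((r - 1) / 2) * x * x ^ ((r - 1) / 2) := by
    conv_rhs => enter [1, 2]; rw [← CFC.rpow_one x hpos.nonneg]
    rw [← CFC.rpow_add hpos.isUnit, ← CFC.rpow_add hpos.isUnit]
    ring_nf
  have h3 : x ^ ((r - 1) / 2) * x * x ^ ((r - 1) / 2) =
      x ^ ((r - 1) / 2) * a * x ^ ((r - 1) / 2) + ε • x ^ (r - 1) := by
    conv_lhs => enter [1, 2]; rw [hx]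
    rw [mul_add, add_mul, Algebra.algebraMap_eq_smul_one, mul_smul_comm, mul_one, smul_mul_assoc,
      ← CFC.rpow_add hpos.isUnit, add_halves]
  rw [h2, h3] at h1
  refine h1.trans (add_le_add_right ?_ _)
  rw [← smul_algebraMap_rpow_sub_one hε]
  exact smul_le_smul_of_nonneg_left
    (add_algebraMap_rpow_le ha hε (by linarith) (by linarith)) hε.le

lemma sqrt_mul_rpow_mul_sqrt_le {a : 𝒜} (ha : 0 ≤ a) {ε : ℝ≥0} (hε : 0 < ε) {r : ℝ} (hr : 0 < r)
    (hr' : r ≤ 1) :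
    CFC.sqrt a * (a + algebraMap ℝ≥0 𝒜 ε) ^ (r - 1) * CFC.sqrt a ≤ a ^ r := by
  have hc : Continuous fun x : ℝ≥0 => (x + ε) ^ (r - 1) :=
    continuous_iff_continuousAt.2 fun x => ContinuousAt.comp
      (NNReal.continuousAt_rpow_const (Or.inl (by positivity))) (by fun_prop)
  have hc' : Continuous fun x : ℝ≥0 => x ^ r := NNReal.continuous_rpow_const hr.le
  have h1 : (a + algebraMap ℝ≥0 𝒜 ε) ^ (r - 1) = cfc (fun x : ℝ≥0 => (x + ε) ^ (r - 1)) a := by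
    have : a + algebraMap ℝ≥0 𝒜 ε = cfc (fun x : ℝ≥0 => x + ε) a := by
      rw [cfc_add_const ε (fun x => x) a, cfc_id' ℝ≥0 a]
    rw [this, CFC.rpow_def, ← cfc_comp' (fun x : ℝ≥0 => x ^ (r - 1)) (fun x => x + ε) a]
  have hs : Continuous fun x : ℝ≥0 => NNReal.sqrt x := NNReal.continuous_sqrt
  rw [h1, CFC.sqrt_eq_cfc, ← cfc_mul _ _ a hs.continuousOn hc.continuousOn,
    ← cfc_mul _ _ a (by exact (hs.mul hc).continuousOn) hs.continuousOn, CFC.rpow_def]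
  refine cfc_mono (fun x _ => ?_) ((hs.mul hc).mul hs).continuousOn hc'.continuousOn
  rw [mul_right_comm, NNReal.mul_self_sqrt]
  rcases eq_or_ne x 0 with rfl | hx
  · simp
  calc x * (x + ε) ^ (r - 1) ≤ x * x ^ (r - 1) := by
        gcongr 1
        exact_mod_cast Real.rpow_le_rpow_of_nonpos (by positivity) (by simp) (by linarith)
    _ = x ^ r := by rw [NNReal.rpow_sub_one hx, mul_div_cancel₀ _ hx]

lemma star_mul_self_mul_le (b a : 𝒜) : star (b * a) * (b * a) ≤ ‖b‖₊ ^ 2 • (star a * a) := by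
  have h := star_left_conjugate_le_conjugate
    (CStarAlgebra.star_mul_le_algebraMap_norm_sq (a := b)) a
  rw [Algebra.algebraMap_eq_smul_one, mul_smul_comm, mul_one, smul_mul_assoc] at h
  simpa [NNReal.smul_def, mul_assoc] using h

lemma star_mul_self_add_le (a b : 𝒜) :
    star (a + b) * (a + b) ≤ (2 : ℝ≥0) • (star a * a) + (2 : ℝ≥0) • (star b * b) := by
  rw [← sub_nonneg]
  have : (2 : ℝ≥0) • (star a * a) + (2 : ℝ≥0) • (star b * b) - star (a + b) * (a + b) =
      star (a - b) * (a - b) := by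
    simp only [star_add, star_sub, two_smul]
    noncomm_ring
  rw [this]
  exact star_mul_self_nonneg _

/-- Conjugation by a unitary is a star automorphism, so it commutes with the functional calculus. -/
lemma rpow_unitary_conj (u : unitary 𝒜) {a : 𝒜} (ha : 0 ≤ a) {r : ℝ} (hr : 0 ≤ r) :
    (star (u : 𝒜) * a * u) ^ r = star (u : 𝒜) * a ^ r * u := by
  have hc : Continuous fun x : ℝ≥0 => x ^ r := NNReal.continuous_rpow_const hr
  have h := StarAlgHomClass.map_cfc (R := ℝ≥0) (S := ℂ) (Unitary.conjStarAlgAut ℂ 𝒜 (star u))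
    (fun x => x ^ r) a (by fun_prop)
      ((by fun_prop : Continuous fun x => star (u : 𝒜) * x * u).congr fun x =>
        (Unitary.conjStarAlgAut_star_apply u x).symm) ha
      (by rw [Unitary.conjStarAlgAut_star_apply]; exact star_left_conjugate_nonneg ha _)
  rw [Unitary.conjStarAlgAut_star_apply, Unitary.conjStarAlgAut_star_apply] at h
  exact h.symm

end CStar

/-! ### Schatten classes -/

section Schatten

open scoped NNReal

variable {E F : Type*} [NormedAddCommGroup E] [InnerProductSpace ℂ E] [CompleteSpace E]
  [NormedAddCommGroup F] [InnerProductSpace ℂ F] [CompleteSpace F]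

/-! ### Traces of nonnegative operators -/

lemma adjoint_comp_self_nonneg (A : E →L[ℂ] F) : 0 ≤ adjoint A ∘L A :=
  (nonneg_iff_isPositive _).2 (isPositive_adjoint_comp_self A)

lemma re_inner_mono {X Y : E →L[ℂ] E} (h : X ≤ Y) (x : E) : (⟪x, X x⟫_ℂ).re ≤ (⟪x, Y x⟫_ℂ).re := by
  have := (ContinuousLinearMap.le_def _ _ |>.1 h).re_inner_nonneg_right x
  rw [sub_apply, inner_sub_right, map_sub, sub_nonneg] at this
  exact this

lemma positiveTrace_mono {X Y : E →L[ℂ] E} (h : X ≤ Y) : positiveTrace X ≤ positiveTrace Y :=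
  ENNReal.tsum_le_tsum fun _ => ENNReal.ofReal_le_ofReal (re_inner_mono h _)

lemma positiveTrace_add_le (X Y : E →L[ℂ] E) :
    positiveTrace (X + Y) ≤ positiveTrace X + positiveTrace Y := by
  rw [positiveTrace, positiveTrace, positiveTrace, ← ENNReal.tsum_add]
  refine ENNReal.tsum_le_tsum fun i => ?_
  rw [add_apply, inner_add_right, Complex.add_re]
  exact ENNReal.ofReal_add_le

lemma positiveTrace_smul (k : ℝ≥0) (X : E →L[ℂ] E) :
    positiveTrace (k • X) = k * positiveTrace X := by
  rw [positiveTrace, positiveTrace, ← ENNReal.tsum_mul_left]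
  refine tsum_congr fun i => ?_
  rw [NNReal.smul_def, smul_apply, inner_smul_right_eq_smul, Complex.smul_re, smul_eq_mul,
    ENNReal.ofReal_mul k.coe_nonneg, ENNReal.ofReal_coe_nnreal]

lemma positiveTrace_adjoint_comp_self (A : E →L[ℂ] F) :
    positiveTrace (adjoint A ∘L A) = hsSq A := by
  refine tsum_congr fun i => ?_
  rw [comp_apply, adjoint_inner_right, enorm_sq_eq_ofReal]
  exact congrArg _ (norm_sq_eq_re_inner (𝕜 := ℂ) _).symm

lemma positiveTrace_star_mul_self (A : E →L[ℂ] E) : positiveTrace (star A * A) = hsSq A :=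
  positiveTrace_adjoint_comp_self A

lemma hsSq_star (A : E →L[ℂ] E) : hsSq (star A) = hsSq A :=
  hsSq_adjoint A

lemma positiveTrace_eq_hsSq_sqrt {X : E →L[ℂ] E} (h : 0 ≤ X) :
    positiveTrace X = hsSq (CFC.sqrt X) := by
  rw [← positiveTrace_star_mul_self, (IsSelfAdjoint.of_nonneg (CFC.sqrt_nonneg X)).star_eq,
    CFC.sqrt_mul_sqrt_self X]

/-- A multiple of the identity may have infinite trace, but over a finite set `s` of basis vectors
it adds only `s.card * δ`. Bounding partial sums thus absorbs the regularization errors. -/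
lemma positiveTrace_le_of_forall_approx {X : E →L[ℂ] E} {M : ℝ≥0∞}
    (h : ∀ δ : ℝ≥0, 0 < δ → ∃ Y : E →L[ℂ] E, positiveTrace Y ≤ M ∧
      ∀ x, (⟪x, X x⟫_ℂ).re ≤ (⟪x, Y x⟫_ℂ).re + δ * ‖x‖ ^ 2) : positiveTrace X ≤ M := by
  rw [positiveTrace, ENNReal.tsum_eq_iSup_sum]
  refine iSup_le fun s => ENNReal.le_of_forall_pos_le_add fun η hη _ => ?_
  obtain ⟨Y, hY, hXY⟩ := h (η / (s.card + 1)) (by positivity)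
  calc ∑ i ∈ s, ENNReal.ofReal (⟪stdBasis E i, X (stdBasis E i)⟫_ℂ).re
      ≤ ∑ i ∈ s, (ENNReal.ofReal (⟪stdBasis E i, Y (stdBasis E i)⟫_ℂ).re +
          ((η / (s.card + 1) : ℝ≥0) : ℝ≥0∞)) := by
        refine Finset.sum_le_sum fun i _ => ?_
        refine (ENNReal.ofReal_le_ofReal (hXY (stdBasis E i))).trans ?_
        rw [(stdBasis E).orthonormal.1 i, one_pow, mul_one]
        refine ENNReal.ofReal_add_le.trans ?_
        rw [ENNReal.ofReal_coe_nnreal]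
    _ = ∑ i ∈ s, ENNReal.ofReal (⟪stdBasis E i, Y (stdBasis E i)⟫_ℂ).re +
          ((s.card * (η / (s.card + 1)) : ℝ≥0) : ℝ≥0∞) := by
        rw [Finset.sum_add_distrib, Finset.sum_const, nsmul_eq_mul]
        push_cast
        rfl
    _ ≤ M + η := by
        refine add_le_add ((ENNReal.sum_le_tsum s).trans hY) ?_
        norm_cast
        rw [mul_div_assoc', div_le_iff₀ (by positivity), mul_comm]
        gcongr
        simp

lemma exists_rpow_lt {r : ℝ} (hr : 0 < r) {δ : ℝ≥0} (hδ : 0 < δ) :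
    ∃ ε : ℝ≥0, 0 < ε ∧ ε ^ r = δ :=
  ⟨δ ^ r⁻¹, NNReal.rpow_pos hδ, NNReal.rpow_inv_rpow hr.ne' δ⟩

lemma re_inner_algebraMap (δ : ℝ≥0) (x : E) :
    (⟪x, algebraMap ℝ≥0 (E →L[ℂ] E) δ x⟫_ℂ).re = δ * ‖x‖ ^ 2 := by
  rw [Algebra.algebraMap_eq_smul_one, NNReal.smul_def, smul_apply, inner_smul_right_eq_smul,
    Complex.smul_re, norm_sq_eq_re_inner (𝕜 := ℂ) x]
  rfl

/-- With `Z = √S W`, `Tr Z⋆Z = Tr ZZ⋆` moves the weight inside `√S · √S`. There `S ≤ X` and the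
negative exponent `r - 1` allow `X` to be replaced by `S`. -/
lemma positiveTrace_conjugate_le {S X : E →L[ℂ] E} (hS : 0 ≤ S) (hSX : S ≤ X) {ε : ℝ≥0}
    (hε : 0 < ε) {r : ℝ} (hr : 0 < r) (hr' : r ≤ 1) :
    positiveTrace ((X + algebraMap ℝ≥0 _ ε) ^ ((r - 1) / 2) * S *
      (X + algebraMap ℝ≥0 _ ε) ^ ((r - 1) / 2)) ≤ positiveTrace (S ^ r) := by
  have hX := hS.trans hSX
  have hpos := add_algebraMap_isStrictlyPositive hX hε
  set W := (X + algebraMap ℝ≥0 (E →L[ℂ] E) ε) ^ ((r - 1) / 2) with hW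
  have hWs : star W = W := (IsSelfAdjoint.of_nonneg CFC.rpow_nonneg).star_eq
  have hRs : star (CFC.sqrt S) = CFC.sqrt S := (IsSelfAdjoint.of_nonneg (CFC.sqrt_nonneg S)).star_eq
  have h1 : W * S * W = star (CFC.sqrt S * W) * (CFC.sqrt S * W) := by
    rw [star_mul, hWs, hRs]
    conv_lhs => enter [1, 2]; rw [← CFC.sqrt_mul_sqrt_self S]
    noncomm_ring
  have h2 : star (star (CFC.sqrt S * W)) * star (CFC.sqrt S * W) = CFC.sqrt S *
      (X + algebraMap ℝ≥0 (E →L[ℂ] E) ε) ^ (r - 1) * CFC.sqrt S := by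
    rw [star_star, star_mul, hWs, hRs, ← add_halves (r - 1), CFC.rpow_add hpos.isUnit, ← hW]
    noncomm_ring
  rw [h1, positiveTrace_star_mul_self, ← hsSq_star, ← positiveTrace_star_mul_self, h2]
  refine positiveTrace_mono (le_trans ?_ (sqrt_mul_rpow_mul_sqrt_le hS hε hr hr'))
  refine conjugate_le_conjugate_of_nonneg ?_ (CFC.sqrt_nonneg S)
  exact rpow_antitone (add_algebraMap_isStrictlyPositive hS hε) (by gcongr) (by linarith)
    (by linarith)

/-- Rotfel'd's inequality for the concave powers. -/
lemma positiveTrace_add_rpow_le {S T : E →L[ℂ] E} (hS : 0 ≤ S) (hT : 0 ≤ T) {r : ℝ} (hr : 0 < r)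
    (hr' : r ≤ 1) :
    positiveTrace ((S + T) ^ r) ≤ positiveTrace (S ^ r) + positiveTrace (T ^ r) := by
  refine positiveTrace_le_of_forall_approx fun δ hδ => ?_
  obtain ⟨ε, hε, rfl⟩ := exists_rpow_lt hr hδ
  -- The weight comes from `S + T`, but the conjugated operator is additive, so `S` and `T` can be
  -- estimated separately.
  refine ⟨(S + T + algebraMap ℝ≥0 _ ε) ^ ((r - 1) / 2) * (S + T) *
    (S + T + algebraMap ℝ≥0 _ ε) ^ ((r - 1) / 2), ?_, fun x => ?_⟩
  rotate_left
  · refine (re_inner_mono (rpow_le_conjugate_add (add_nonneg hS hT) hε hr.le hr') x).trans ?_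
    rw [add_apply, inner_add_right, Complex.add_re, re_inner_algebraMap]
  · rw [mul_add, add_mul]
    exact (positiveTrace_add_le _ _).trans (add_le_add
      (positiveTrace_conjugate_le hS (le_add_of_nonneg_right hT) hε hr hr')
      (positiveTrace_conjugate_le hT (le_add_of_nonneg_left hS) hε hr hr'))

/-! ### Schatten classes as two-sided ideals -/

lemma memSchatten_iff (p : ℝ) (A : E →L[ℂ] E) :
    MemSchatten p A ↔ positiveTrace ((star A * A) ^ (p / 2)) < ∞ :=
  Iff.rfl

lemma MemSchatten.mul_left {p : ℝ} (hp : 0 < p) (hp2 : p ≤ 2) {A : E →L[ℂ] E}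
    (hA : MemSchatten p A) (B : E →L[ℂ] E) : MemSchatten p (B * A) := by
  rw [memSchatten_iff] at *
  have h := CFC.rpow_le_rpow (p := p / 2) ⟨by linarith, by linarith⟩ (star_mul_self_mul_le B A)
  rw [smul_rpow _ (star_mul_self_nonneg A) (by linarith)] at h
  refine (positiveTrace_mono h).trans_lt ?_
  rw [positiveTrace_smul]
  exact ENNReal.mul_lt_top ENNReal.coe_lt_top hA

lemma MemSchatten.smul {p : ℝ} (hp : 0 < p) (hp2 : p ≤ 2) {A : E →L[ℂ] E}
    (hA : MemSchatten p A) (c : ℂ) : MemSchatten p (c • A) := by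
  simpa using hA.mul_left hp hp2 (c • 1)

lemma MemSchatten.add {p : ℝ} (hp : 0 < p) (hp2 : p ≤ 2) {A B : E →L[ℂ] E}
    (hA : MemSchatten p A) (hB : MemSchatten p B) : MemSchatten p (A + B) := by
  rw [memSchatten_iff] at *
  have h0 : ∀ C : E →L[ℂ] E, 0 ≤ (2 : ℝ≥0) • (star C * C) := fun C =>
    smul_nonneg zero_le (star_mul_self_nonneg C)
  have h := CFC.rpow_le_rpow (p := p / 2) ⟨by linarith, by linarith⟩ (star_mul_self_add_le A B)
  refine (positiveTrace_mono h).trans_lt ((positiveTrace_add_rpow_le (h0 A) (h0 B) (by linarith)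
    (by linarith)).trans_lt ?_)
  rw [smul_rpow _ (star_mul_self_nonneg A) (by linarith),
    smul_rpow _ (star_mul_self_nonneg B) (by linarith), positiveTrace_smul, positiveTrace_smul]
  exact ENNReal.add_lt_top.2 ⟨ENNReal.mul_lt_top ENNReal.coe_lt_top hA,
    ENNReal.mul_lt_top ENNReal.coe_lt_top hB⟩

lemma memSchatten_zero {p : ℝ} (hp : 0 < p) : MemSchatten p (0 : E →L[ℂ] E) := by
  have h : (0 : E →L[ℂ] E) ^ (p / 2) = 0 := CFC.zero_rpow (by linarith)
  rw [memSchatten_iff, mul_zero, h]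
  simp [positiveTrace]

/-- The unitary passes through the power, so the trace becomes the Hilbert–Schmidt norm squared of
`√(|A|^p) u`. -/
lemma MemSchatten.mul_unitary {p : ℝ} (hp : 0 < p) {A : E →L[ℂ] E} (hA : MemSchatten p A)
    (u : unitary (E →L[ℂ] E)) : MemSchatten p (A * (u : E →L[ℂ] E)) := by
  rw [memSchatten_iff] at *
  have h1 : star (A * (u : E →L[ℂ] E)) * (A * (u : E →L[ℂ] E)) =
      star (u : E →L[ℂ] E) * (star A * A) * u := by
    rw [star_mul]
    noncomm_ring
  have h0 : 0 ≤ (star A * A) ^ (p / 2) := CFC.rpow_nonneg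
  have hRs := (IsSelfAdjoint.of_nonneg (CFC.sqrt_nonneg ((star A * A) ^ (p / 2)))).star_eq
  rw [positiveTrace_eq_hsSq_sqrt h0] at hA
  rw [h1, rpow_unitary_conj u (star_mul_self_nonneg A) (by linarith)]
  have h2 : star (u : E →L[ℂ] E) * (star A * A) ^ (p / 2) * u =
      star (CFC.sqrt ((star A * A) ^ (p / 2)) * u) * (CFC.sqrt ((star A * A) ^ (p / 2)) * u) := by
    rw [star_mul, hRs]
    conv_lhs => rw [← CFC.sqrt_mul_sqrt_self _ h0]
    noncomm_ring
  rw [h2, positiveTrace_star_mul_self]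
  exact (IsHS.comp_right hA.ne (u : E →L[ℂ] E)).lt_top

/-- Every operator is a linear combination of unitaries, so the unitary case suffices. -/
lemma MemSchatten.mul_right {p : ℝ} (hp : 0 < p) (hp2 : p ≤ 2) {A : E →L[ℂ] E}
    (hA : MemSchatten p A) (B : E →L[ℂ] E) : MemSchatten p (A * B) := by
  have hB : B ∈ Submodule.span ℂ (unitary (E →L[ℂ] E) : Set (E →L[ℂ] E)) := by
    rw [CStarAlgebra.span_unitary]
    trivial
  induction hB using Submodule.span_induction with
  | mem u hu => exact MemSchatten.mul_unitary hp hA ⟨u, hu⟩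
  | zero => simpa using memSchatten_zero hp
  | add B C _ _ hB hC => simpa [mul_add] using hB.add hp hp2 hC
  | smul c B _ hB => simpa using hB.smul hp hp2 c

lemma MemSchatten.mono {p q : ℝ} (hp : 0 < p) (hpq : p ≤ q) {A : E →L[ℂ] E}
    (hA : MemSchatten p A) : MemSchatten q A := by
  rw [memSchatten_iff] at *
  refine (positiveTrace_mono (rpow_le_smul_rpow (star_mul_self_nonneg A) (half_pos hp)
    (by linarith : p / 2 ≤ q / 2))).trans_lt ?_
  rw [positiveTrace_smul]
  exact ENNReal.mul_lt_top ENNReal.coe_lt_top hA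

/-! ### Comparison of norms and products of Hilbert–Schmidt operators -/

lemma enorm_apply_sq_le_hsSq (R : E →L[ℂ] F) (x : E) : ‖R x‖ₑ ^ 2 ≤ hsSq R * ‖x‖ₑ ^ 2 := by
  rw [enorm_sq_eq_tsum (stdBasis F) (R x), ← hsSq_adjoint, hsSq, ← ENNReal.tsum_mul_right]
  refine ENNReal.tsum_le_tsum fun j => ?_
  rw [← adjoint_inner_left, ← mul_pow]
  gcongr
  rw [← ofReal_norm, ← ofReal_norm, ← ofReal_norm, ← ENNReal.ofReal_mul (norm_nonneg _)]
  exact ENNReal.ofReal_le_ofReal (norm_inner_le_norm _ _)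

lemma norm_sq_le_hsSq {R : E →L[ℂ] F} (hR : IsHS R) : ‖R‖ ^ 2 ≤ (hsSq R).toReal := by
  refine (Real.le_sqrt (norm_nonneg _) ENNReal.toReal_nonneg).1
    (R.opNorm_le_bound (Real.sqrt_nonneg _) fun x => ?_)
  refine Real.le_sqrt_of_sq_le ?_ |>.trans_eq (Real.sqrt_mul_self (by positivity))
  have h := enorm_apply_sq_le_hsSq R x
  rw [← ENNReal.toReal_le_toReal (by simp) (ENNReal.mul_ne_top hR (by simp))] at h
  simp only [ENNReal.toReal_mul, ENNReal.toReal_pow, toReal_enorm] at h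
  rw [← sq, mul_pow, Real.sq_sqrt ENNReal.toReal_nonneg]
  exact h

lemma norm_le_positiveTrace {X : E →L[ℂ] E} (h : 0 ≤ X) (hX : positiveTrace X ≠ ∞) :
    ‖X‖ ≤ (positiveTrace X).toReal := by
  rw [positiveTrace_eq_hsSq_sqrt h] at hX ⊢
  have := norm_sq_le_hsSq hX
  rwa [CFC.norm_sqrt X h, Real.sq_sqrt (norm_nonneg _)] at this

/-- With `τ = Tr |A|^p`, combine `Tr |A|² ≤ ‖A⋆A‖ ^ (1 - p/2) * τ` and `‖A⋆A‖ ^ (p/2) ≤ τ`. -/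
lemma isHS_and_sqrt_hsSq_le_schattenNorm {p : ℝ} (hp : 0 < p) (hp2 : p ≤ 2) {A : E →L[ℂ] E}
    (hA : MemSchatten p A) : IsHS A ∧ √(hsSq A).toReal ≤ schattenNorm p A := by
  have hA' := hA
  rw [memSchatten_iff] at hA'
  have h0 : 0 ≤ star A * A := star_mul_self_nonneg A
  have h1 := positiveTrace_mono (rpow_le_smul_rpow h0 (half_pos hp) (by linarith : p / 2 ≤ 1))
  rw [CFC.rpow_one _ h0, positiveTrace_star_mul_self, positiveTrace_smul] at h1
  have hne := ENNReal.mul_ne_top (ENNReal.coe_ne_top (r := ‖star A * A‖₊ ^ (1 - p / 2))) hA'.ne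
  refine ⟨ne_top_of_le_ne_top hne h1, ?_⟩
  have h2 := ENNReal.toReal_mono hne h1
  have h3 := norm_le_positiveTrace CFC.rpow_nonneg hA'.ne
  rw [CFC.norm_rpow _ (half_pos hp) h0] at h3
  rw [ENNReal.toReal_mul, ENNReal.coe_toReal, NNReal.coe_rpow, coe_nnnorm] at h2
  have ht : schattenTrace p A = positiveTrace ((star A * A) ^ (p / 2)) := rfl
  rw [schattenNorm, ht]
  set τ := (positiveTrace ((star A * A) ^ (p / 2))).toReal
  have hτ : 0 ≤ τ := ENNReal.toReal_nonneg
  have h4 : ‖star A * A‖ ≤ τ ^ (2 / p) := by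
    have := Real.rpow_le_rpow (by positivity) h3 (by positivity : 0 ≤ 2 / p)
    rwa [← Real.rpow_mul (norm_nonneg _), div_mul_div_comm, mul_comm p 2, div_self (by positivity),
      Real.rpow_one] at this
  refine Real.sqrt_le_iff.2 ⟨by positivity, h2.trans ?_⟩
  calc ‖star A * A‖ ^ (1 - p / 2) * τ ≤ (τ ^ (2 / p)) ^ (1 - p / 2) * τ := by
        gcongr
        linarith
    _ = τ ^ (2 / p - 1) * τ ^ (1 : ℝ) := by
        rw [← Real.rpow_mul hτ, Real.rpow_one]
        congr 2
        field_simp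
    _ = (τ ^ (1 / p)) ^ 2 := by
        have : 0 ≤ 2 / p - 1 := by
          rw [sub_nonneg, le_div_iff₀ hp]
          linarith
        rw [← Real.rpow_add_of_nonneg hτ this zero_le_one, ← Real.rpow_mul_natCast hτ]
        congr 1
        push_cast
        ring

/-- Regularized polar decomposition: `V = (T + ε) ^ (-1/2)` stands for `|XY|⁻¹`, and `W = XYV` for
the partial isometry. Then `V T = W⋆ X Y`, whose coefficients `⟪X⋆ W e, Y e⟫` are summable because
`W` is a contraction. -/
lemma memSchatten_one_comp {X : F →L[ℂ] E} {Y : E →L[ℂ] F} (hX : IsHS X) (hY : IsHS Y) :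
    MemSchatten 1 (X ∘L Y) := by
  set T := adjoint (X ∘L Y) ∘L (X ∘L Y) with hT
  have hT0 : 0 ≤ T := adjoint_comp_self_nonneg _
  suffices h : positiveTrace (T ^ (1 / 2 : ℝ)) ≤ hsSq X + hsSq Y from
    h.trans_lt (ENNReal.add_lt_top.2 ⟨hX.lt_top, hY.lt_top⟩)
  refine positiveTrace_le_of_forall_approx fun δ hδ => ?_
  obtain ⟨ε, hε, hεδ⟩ := exists_rpow_lt (r := 1 / 2) (by norm_num) hδ
  have hpos := add_algebraMap_isStrictlyPositive hT0 hε
  set Z := T + algebraMap ℝ≥0 (E →L[ℂ] E) ε with hZ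
  set V := Z ^ (-(1 / 2) : ℝ) with hV
  have hVs : adjoint V = V := (IsSelfAdjoint.of_nonneg CFC.rpow_nonneg).star_eq
  have hVT : V * T * V ≤ 1 := by
    have h1 : V * T * V ≤ V * Z * V := conjugate_le_conjugate_of_nonneg
      (le_add_of_nonneg_right (algebraMap_isStrictlyPositive hε).nonneg) CFC.rpow_nonneg
    have h2 : V * Z * V = 1 := by
      conv_lhs => enter [1, 2]; rw [← CFC.rpow_one Z hpos.nonneg]
      rw [hV, ← CFC.rpow_add hpos.isUnit, ← CFC.rpow_add hpos.isUnit]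
      norm_num [CFC.rpow_zero Z hpos.nonneg]
    rwa [h2] at h1
  set W := X ∘L Y ∘L V with hW
  have hWT : adjoint W ∘L W = V * T * V := by
    rw [hW, adjoint_comp, adjoint_comp, hVs, hT, adjoint_comp]
    rfl
  have hWn : ‖W‖ₑ ≤ 1 := by
    have : ‖W‖ ≤ 1 := W.opNorm_le_bound zero_le_one fun x => by
      have h := re_inner_mono hVT x
      rw [← hWT, comp_apply, adjoint_inner_right] at h
      have h' : ‖W x‖ ^ 2 ≤ ‖x‖ ^ 2 := by
        rw [norm_sq_eq_re_inner (𝕜 := ℂ) x, norm_sq_eq_re_inner (𝕜 := ℂ) (W x)]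
        exact h
      rw [one_mul]
      exact (sq_le_sq₀ (norm_nonneg _) (norm_nonneg _)).1 h'
    rw [← ofReal_norm]
    exact ENNReal.ofReal_le_one.2 this
  have hVTW : ∀ x, ⟪x, (V * T) x⟫_ℂ = ⟪adjoint X (W x), Y x⟫_ℂ := fun x => by
    have : V * T = adjoint W ∘L X ∘L Y := by
      rw [hW, adjoint_comp, adjoint_comp, hVs, hT, adjoint_comp]
      rfl
    rw [this, comp_apply, comp_apply, adjoint_inner_right, adjoint_inner_left]
  refine ⟨V * T, ?_, fun x => ?_⟩
  · have hXW : hsSq (adjoint X ∘L W) ≤ hsSq X := by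
      rw [← hsSq_adjoint, adjoint_comp, adjoint_adjoint]
      refine (hsSq_comp_le _ _).trans ?_
      rw [show ‖adjoint W‖ₑ = ‖W‖ₑ by
        rw [← ofReal_norm, ← ofReal_norm, LinearIsometryEquiv.norm_map]]
      calc ‖W‖ₑ ^ 2 * hsSq X ≤ 1 ^ 2 * hsSq X := by gcongr
        _ = hsSq X := by simp
    refine le_trans ?_ (add_le_add_left hXW (hsSq Y))
    rw [positiveTrace, hsSq, hsSq, ← ENNReal.tsum_add]
    refine ENNReal.tsum_le_tsum fun i => ?_
    rw [enorm_sq_eq_ofReal, enorm_sq_eq_ofReal,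
      ← ENNReal.ofReal_add (by positivity) (by positivity)]
    refine ENNReal.ofReal_le_ofReal ?_
    rw [hVTW]
    change _ ≤ ‖adjoint X (W (stdBasis E i))‖ ^ 2 + ‖Y (stdBasis E i)‖ ^ 2
    refine (Complex.re_le_norm _).trans ((norm_inner_le_norm _ _).trans ?_)
    nlinarith [sq_nonneg (‖adjoint X (W (stdBasis E i))‖ - ‖Y (stdBasis E i)‖),
      sq_nonneg ‖adjoint X (W (stdBasis E i))‖, sq_nonneg ‖Y (stdBasis E i)‖]
  -- `√T ≤ √Z = V Z = V T + ε V`, and `ε V ≤ √ε = δ`.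
  · have h1 : T ^ (1 / 2 : ℝ) ≤ V * T + ε • V := by
      have h2 : Z ^ (1 / 2 : ℝ) = V * T + ε • V := by
        have : V * T + ε • V = V * Z := by
          rw [hZ, mul_add, Algebra.algebraMap_eq_smul_one, mul_smul_comm, mul_one]
        rw [this]
        conv_rhs => enter [2]; rw [← CFC.rpow_one Z hpos.nonneg]
        rw [hV, ← CFC.rpow_add hpos.isUnit]
        norm_num
      rw [← h2]
      exact CFC.rpow_le_rpow ⟨by norm_num, by norm_num⟩
        (le_add_of_nonneg_right (algebraMap_isStrictlyPositive hε).nonneg)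
    have h3 : ε • V ≤ algebraMap ℝ≥0 _ δ := by
      rw [← hεδ, ← smul_algebraMap_rpow_sub_one hε]
      refine smul_le_smul_of_nonneg_left ?_ hε.le
      have := add_algebraMap_rpow_le hT0 hε (t := 1 / 2 - 1) (by norm_num) (by norm_num)
      rwa [show (1 / 2 - 1 : ℝ) = -(1 / 2) by norm_num] at this ⊢
    have h4 := re_inner_mono (h1.trans (add_le_add_right h3 _)) x
    rwa [add_apply, inner_add_right, Complex.add_re, re_inner_algebraMap] at h4

end Schatten

/-! ### The Schwinger term -/

/-- The diagonal matrix coefficients are summable. -/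
def HasTrace {E : Type*} [NormedAddCommGroup E] [InnerProductSpace ℂ E] [CompleteSpace E]
    (T : E →L[ℂ] E) : Prop :=
  Summable fun i => ⟪stdBasis E i, T (stdBasis E i)⟫_ℂ

section HasTrace

variable {E : Type*} [NormedAddCommGroup E] [InnerProductSpace ℂ E] [CompleteSpace E]

lemma IsHS.hasTrace_mul {X Y : E →L[ℂ] E} (hX : IsHS X) (hY : IsHS Y) : HasTrace (X * Y) :=
  (hasSum_trace_comp (stdBasis E) hX hY).summable

lemma IsHS.mul_left {X : E →L[ℂ] E} (hX : IsHS X) (Y : E →L[ℂ] E) : IsHS (Y * X) :=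
  hX.comp_left Y

lemma IsHS.mul_right {X : E →L[ℂ] E} (hX : IsHS X) (Y : E →L[ℂ] E) : IsHS (X * Y) :=
  hX.comp_right Y

lemma HasTrace.add {S T : E →L[ℂ] E} (hS : HasTrace S) (hT : HasTrace T) : HasTrace (S + T) :=
  (Summable.add hS hT).congr fun i => by rw [add_apply, inner_add_right]

lemma trace_add {S T : E →L[ℂ] E} (hS : HasTrace S) (hT : HasTrace T) :
    trace (S + T) = trace S + trace T := by
  rw [trace, trace, trace, ← Summable.tsum_add hS hT]
  exact tsum_congr fun i => by rw [add_apply, inner_add_right]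

lemma HasTrace.neg {T : E →L[ℂ] E} (hT : HasTrace T) : HasTrace (-T) :=
  (Summable.neg hT).congr fun i => by rw [neg_apply, inner_neg_right]

lemma trace_neg (T : E →L[ℂ] E) : trace (-T) = -trace T := by
  simpa using trace_smul (-1) T

lemma trace_mul_comm {X Y : E →L[ℂ] E} (hX : IsHS X) (hY : IsHS Y) :
    trace (X * Y) = trace (Y * X) :=
  trace_comp_comm hX hY

end HasTrace

section Polarized

variable {H : Type*} [NormedAddCommGroup H] [InnerProductSpace ℂ H] [CompleteSpace H]
  (Hp : Submodule ℂ H) [CompleteSpace Hp]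

/-! ### The operator `d` and diagonal blocks -/

lemma d_apply (x : H) : d Hp x = Complex.I • (Hp.starProjection x - Hpᗮ.starProjection x) := rfl

lemma d_apply_of_mem {x : H} (hx : x ∈ Hp) : d Hp x = Complex.I • x := by
  rw [d_apply, Submodule.starProjection_eq_self_iff.2 hx,
    Submodule.starProjection_orthogonal_apply_eq_zero hx, sub_zero]

lemma d_apply_of_mem_orthogonal {x : H} (hx : x ∈ Hpᗮ) : d Hp x = -Complex.I • x := by
  rw [d_apply, Submodule.starProjection_eq_self_iff.2 hx,
    (Submodule.starProjection_apply_eq_zero_iff Hp).2 hx, zero_sub, smul_neg, neg_smul]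

lemma d_mul_d : d Hp * d Hp = -1 := by
  ext x
  have h1 := d_apply_of_mem Hp (Hp.starProjection_apply_mem x)
  have h2 := d_apply_of_mem_orthogonal Hp (Hpᗮ.starProjection_apply_mem x)
  have h3 := Submodule.starProjection_add_starProjection_orthogonal (K := Hp) x
  change d Hp (d Hp x) = -x
  conv_rhs => rw [← h3]
  rw [d_apply Hp x, map_smul, map_sub, h1, h2, neg_smul, sub_neg_eq_add, ← smul_add, smul_smul,
    Complex.I_mul_I, neg_one_smul]

lemma norm_d_le : ‖d Hp‖ ≤ 2 := by
  rw [d, norm_smul, Complex.norm_I, one_mul]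
  exact (norm_sub_le _ _).trans
    (by linarith [Hp.starProjection_norm_le, Hpᗮ.starProjection_norm_le])

/-- `d [d, A] + [d, A] d = [d², A] = 0`. -/
lemma lie_d_mul_d (A : H →L[ℂ] H) : ⁅d Hp, A⁆ * d Hp = -(d Hp * ⁅d Hp, A⁆) := by
  rw [Ring.lie_def, sub_mul, mul_sub, mul_assoc A, d_mul_d, ← mul_assoc (d Hp) (d Hp), d_mul_d]
  noncomm_ring

lemma orthogonalProjectionOnto_d (x : H) :
    Hp.orthogonalProjectionOnto (d Hp x) = Complex.I • Hp.orthogonalProjectionOnto x := by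
  rw [d_apply, map_smul, map_sub, Submodule.orthogonalProjectionOnto_starProjection_of_le le_rfl,
    Submodule.orthogonalProjectionOnto_eq_zero_iff.2 (Hpᗮ.starProjection_apply_mem x),
    sub_zero]

lemma orthogonalProjectionOnto_orthogonal_d (x : H) :
    Hpᗮ.orthogonalProjectionOnto (d Hp x) = -Complex.I • Hpᗮ.orthogonalProjectionOnto x := by
  rw [d_apply, map_smul, map_sub, Submodule.orthogonalProjectionOnto_starProjection_of_le le_rfl,
    Submodule.orthogonalProjectionOnto_eq_zero_iff.2
      (Hp.le_orthogonal_orthogonal (Hp.starProjection_apply_mem x)),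
    zero_sub, smul_neg, neg_smul]

lemma eq_zero_of_I_smul_eq_neg {V : Type*} [AddCommGroup V] [Module ℂ V] {v : V}
    (h : Complex.I • v = -(Complex.I • v)) : v = 0 := by
  have : (2 * Complex.I) • v = 0 := by
    rw [mul_smul, two_smul]
    nth_rewrite 1 [h]
    exact neg_add_cancel _
  exact (smul_eq_zero.1 this).resolve_left (by simp)

/-- On `H₊` the operator `d` is the scalar `i` on either side of `Z`, so the block equals its own
negative. -/
lemma blockPlus_eq_zero {Z : H →L[ℂ] H} (h : d Hp * Z = -(Z * d Hp)) : blockPlus Hp Z = 0 := by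
  ext1 x
  have h1 := congrArg Hp.orthogonalProjectionOnto (DFunLike.congr_fun h (x : H))
  change Hp.orthogonalProjectionOnto (d Hp (Z x)) = Hp.orthogonalProjectionOnto (-Z (d Hp x)) at h1
  rw [orthogonalProjectionOnto_d, d_apply_of_mem Hp x.2, map_smul, map_neg, map_smul] at h1
  exact eq_zero_of_I_smul_eq_neg h1

lemma blockMinus_eq_zero {Z : H →L[ℂ] H} (h : d Hp * Z = -(Z * d Hp)) : blockMinus Hp Z = 0 := by
  ext1 x
  have h1 := congrArg Hpᗮ.orthogonalProjectionOnto (DFunLike.congr_fun h (x : H))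
  change Hpᗮ.orthogonalProjectionOnto (d Hp (Z x)) =
    Hpᗮ.orthogonalProjectionOnto (-Z (d Hp x)) at h1
  rw [orthogonalProjectionOnto_orthogonal_d, d_apply_of_mem_orthogonal Hp x.2, map_smul, map_neg,
    map_smul, neg_smul] at h1
  exact eq_zero_of_I_smul_eq_neg (neg_injective h1)

/-- The off-diagonal part of `A`. -/
def offDiag (A : H →L[ℂ] H) : H →L[ℂ] H :=
  (-(1 / 2) : ℂ) • (d Hp * ⁅d Hp, A⁆)

lemma d_mul_sub_offDiag (A : H →L[ℂ] H) :
    d Hp * (A - offDiag Hp A) = (A - offDiag Hp A) * d Hp := by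
  have h : d Hp * (d Hp * ⁅d Hp, A⁆) = -⁅d Hp, A⁆ := by
    rw [← mul_assoc, d_mul_d, neg_one_mul]
  have h' : d Hp * ⁅d Hp, A⁆ * d Hp = ⁅d Hp, A⁆ := by
    rw [mul_assoc, lie_d_mul_d, mul_neg, h, neg_neg]
  rw [offDiag, mul_sub, sub_mul, mul_smul_comm, smul_mul_assoc, h, h', smul_neg, sub_neg_eq_add,
    ← eq_sub_iff_add_eq, sub_sub, ← add_smul, ← sub_eq_zero, sub_sub_eq_add_sub, add_sub_right_comm,
    ← Ring.lie_def]
  module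

lemma d_mul_sub_offDiag_mul (A B : H →L[ℂ] H) :
    d Hp * ((A - offDiag Hp A) * ⁅d Hp, B⁆) = -((A - offDiag Hp A) * ⁅d Hp, B⁆ * d Hp) := by
  rw [← mul_assoc, d_mul_sub_offDiag, mul_assoc, mul_assoc, lie_d_mul_d, mul_neg, neg_neg]

/-- The compression of a product `X Y` to a closed subspace, written as a product. -/
def compression (K : Submodule ℂ H) [CompleteSpace K] (X Y : H →L[ℂ] H) : K →L[ℂ] K :=
  (K.orthogonalProjectionOnto ∘L X) ∘L (Y ∘L K.subtypeL)

/-- Cyclicity between `K` and `H`: the inclusion and the projection meet and form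
`K.starProjection`. -/
lemma trace_compression (K : Submodule ℂ H) [CompleteSpace K] {X Y : H →L[ℂ] H} (hX : IsHS X)
    (hY : IsHS Y) : trace (compression K X Y) = trace (Y * (K.starProjection * X)) :=
  (trace_comp_comm (hX.comp_left K.orthogonalProjectionOnto) (hY.comp_right K.subtypeL)).trans rfl

lemma memSchatten_compression (K : Submodule ℂ H) [CompleteSpace K] {X Y : H →L[ℂ] H}
    (hX : IsHS X) (hY : IsHS Y) : MemSchatten 1 (compression K X Y) :=
  memSchatten_one_comp (hX.comp_left K.orthogonalProjectionOnto) (hY.comp_right K.subtypeL)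

lemma hasSum_trace_compression (K : Submodule ℂ H) [CompleteSpace K] {X Y : H →L[ℂ] H}
    (hX : IsHS X) (hY : IsHS Y) {ι : Type*} (e : HilbertBasis ι ℂ K) :
    HasSum (fun i => ⟪e i, compression K X Y (e i)⟫_ℂ) (trace (compression K X Y)) :=
  hasSum_trace_comp e (hX.comp_left K.orthogonalProjectionOnto) (hY.comp_right K.subtypeL)

/-- The part of `A` commuting with `d` contributes nothing; what remains is a product of two
Hilbert–Schmidt factors once both commutators are Hilbert–Schmidt. -/
lemma blockPlus_mul_lie (A B : H →L[ℂ] H) : blockPlus Hp (A * ⁅d Hp, B⁆) =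
    compression Hp (offDiag Hp A) ⁅d Hp, B⁆ := by
  have h := blockPlus_eq_zero Hp (d_mul_sub_offDiag_mul Hp A B)
  ext1 x
  have hx := DFunLike.congr_fun h x
  change Hp.orthogonalProjectionOnto (A _ - offDiag Hp A _) = 0 at hx
  rw [map_sub, sub_eq_zero] at hx
  exact hx

lemma blockMinus_mul_lie (A B : H →L[ℂ] H) : blockMinus Hp (A * ⁅d Hp, B⁆) =
    compression Hpᗮ (offDiag Hp A) ⁅d Hp, B⁆ := by
  have h := blockMinus_eq_zero Hp (d_mul_sub_offDiag_mul Hp A B)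
  ext1 x
  have hx := DFunLike.congr_fun h x
  change Hpᗮ.orthogonalProjectionOnto (A _ - offDiag Hp A _) = 0 at hx
  rw [map_sub, sub_eq_zero] at hx
  exact hx

variable {Hp}

lemma isHS_offDiag {A : H →L[ℂ] H} (hA : IsHS ⁅d Hp, A⁆) : IsHS (offDiag Hp A) :=
  (hA.comp_left (d Hp)).smul _

lemma trace_compression_add {X Y : H →L[ℂ] H} (hX : IsHS X) (hY : IsHS Y) :
    trace (compression Hp X Y) + trace (compression Hpᗮ X Y) = trace (X * Y) := by
  have h : Y * (Hp.starProjection * X) + Y * (Hpᗮ.starProjection * X) = Y * X := by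
    ext1 x
    have h2 := Submodule.starProjection_add_starProjection_orthogonal (K := Hp) (X x)
    exact (map_add Y _ _).symm.trans (congrArg Y h2)
  rw [trace_compression Hp hX hY, trace_compression Hpᗮ hX hY,
    ← trace_add (hY.hasTrace_mul (hX.mul_left _)) (hY.hasTrace_mul (hX.mul_left _)), h,
    trace_mul_comm hY hX]

lemma schwinger_eq {A B : H →L[ℂ] H} (hA : IsHS ⁅d Hp, A⁆) (hB : IsHS ⁅d Hp, B⁆) :
    schwinger Hp A B = -(1 / 2) * trace (d Hp * ⁅d Hp, A⁆ * ⁅d Hp, B⁆) := by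
  rw [schwinger, resTrace, blockPlus_mul_lie, blockMinus_mul_lie,
    trace_compression_add (isHS_offDiag hA) hB, offDiag, smul_mul_assoc, trace_smul]

/-- Cauchy–Schwarz; the factor `1/2` in `schwinger_eq` absorbs the crude bound `‖d‖ ≤ 2`. -/
lemma norm_schwinger_le {A B : H →L[ℂ] H} (hA : IsHS ⁅d Hp, A⁆) (hB : IsHS ⁅d Hp, B⁆) :
    ‖schwinger Hp A B‖ ≤ √(hsSq ⁅d Hp, A⁆).toReal * √(hsSq ⁅d Hp, B⁆).toReal := by
  have h1 := norm_trace_comp_le (hA.comp_left (d Hp)) hB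
  have h2 : √(hsSq (d Hp ∘L ⁅d Hp, A⁆)).toReal ≤ 2 * √(hsSq ⁅d Hp, A⁆).toReal := by
    refine Real.sqrt_le_iff.2 ⟨by positivity, ?_⟩
    have := ENNReal.toReal_mono (ENNReal.mul_ne_top (by simp) hA) (hsSq_comp_le (d Hp) ⁅d Hp, A⁆)
    rw [ENNReal.toReal_mul, ENNReal.toReal_pow, toReal_enorm] at this
    rw [mul_pow, Real.sq_sqrt ENNReal.toReal_nonneg]
    refine this.trans ?_
    gcongr
    exact norm_d_le Hp
  rw [schwinger_eq hA hB, norm_mul]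
  have h3 : ‖(-(1 / 2) : ℂ)‖ = 1 / 2 := by norm_num
  rw [h3]
  have h4 := mul_le_mul_of_nonneg_right h2 (Real.sqrt_nonneg (hsSq ⁅d Hp, B⁆).toReal)
  have h5 : ‖trace (d Hp * ⁅d Hp, A⁆ * ⁅d Hp, B⁆)‖ ≤ _ := h1.trans h4
  linarith

variable (Hp) in
lemma lie_d_add (A B : H →L[ℂ] H) : ⁅d Hp, A + B⁆ = ⁅d Hp, A⁆ + ⁅d Hp, B⁆ := by
  simp only [Ring.lie_def]
  noncomm_ring

variable (Hp) in
lemma lie_d_mul (A B : H →L[ℂ] H) : ⁅d Hp, A * B⁆ = ⁅d Hp, A⁆ * B + A * ⁅d Hp, B⁆ := by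
  simp only [Ring.lie_def]
  noncomm_ring

variable (Hp) in
lemma lie_d_lie (A B : H →L[ℂ] H) : ⁅d Hp, ⁅A, B⁆⁆ =
    ⁅d Hp, A⁆ * B + A * ⁅d Hp, B⁆ + -(⁅d Hp, B⁆ * A) + -(B * ⁅d Hp, A⁆) := by
  simp only [Ring.lie_def]
  noncomm_ring

lemma isHS_lie_d_lie {A B : H →L[ℂ] H} (hA : IsHS ⁅d Hp, A⁆) (hB : IsHS ⁅d Hp, B⁆) :
    IsHS ⁅d Hp, ⁅A, B⁆⁆ := by
  rw [lie_d_lie]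
  exact (((hA.mul_right B).add (hB.mul_left A)).add (hB.mul_right A).neg).add
    (hA.mul_left B).neg

lemma schwinger_skew {A B : H →L[ℂ] H} (hA : IsHS ⁅d Hp, A⁆) (hB : IsHS ⁅d Hp, B⁆) :
    schwinger Hp A B = -schwinger Hp B A := by
  rw [schwinger_eq hA hB, schwinger_eq hB hA, trace_mul_comm (hA.mul_left (d Hp)) hB, ← mul_assoc,
    lie_d_mul_d, neg_mul (d Hp * _), trace_neg]
  ring

lemma schwinger_add_left {A A' B : H →L[ℂ] H} (hA : IsHS ⁅d Hp, A⁆) (hA' : IsHS ⁅d Hp, A'⁆)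
    (hB : IsHS ⁅d Hp, B⁆) : schwinger Hp (A + A') B = schwinger Hp A B + schwinger Hp A' B := by
  have h : IsHS ⁅d Hp, A + A'⁆ := by
    rw [lie_d_add]
    exact hA.add hA'
  rw [schwinger_eq h hB, schwinger_eq hA hB, schwinger_eq hA' hB, lie_d_add, mul_add, add_mul,
    trace_add ((hA.mul_left (d Hp)).hasTrace_mul hB) ((hA'.mul_left (d Hp)).hasTrace_mul hB),
    mul_add]

lemma lie_d_smul (c : ℂ) (A : H →L[ℂ] H) : ⁅d Hp, c • A⁆ = c • ⁅d Hp, A⁆ := by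
  rw [Ring.lie_def, Ring.lie_def, mul_smul_comm, smul_mul_assoc, smul_sub]

lemma schwinger_smul_left {A B : H →L[ℂ] H} (hA : IsHS ⁅d Hp, A⁆) (hB : IsHS ⁅d Hp, B⁆) (c : ℂ) :
    schwinger Hp (c • A) B = c * schwinger Hp A B := by
  have h : IsHS ⁅d Hp, c • A⁆ := by
    rw [lie_d_smul]
    exact hA.smul c
  rw [schwinger_eq h hB, schwinger_eq hA hB, lie_d_smul, mul_smul_comm, smul_mul_assoc, trace_smul]
  ring

/-- Cyclicity brings `[d, C]` to the front; passing it through `d` costs the sign. All terms of the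
cocycle sum then take the form `Tr(d [d, X] Y [d, Z])`. -/
lemma trace_d_mul_mul_mul (A : H →L[ℂ] H) {B C : H →L[ℂ] H} (hB : IsHS ⁅d Hp, B⁆)
    (hC : IsHS ⁅d Hp, C⁆) : trace (d Hp * (A * ⁅d Hp, B⁆) * ⁅d Hp, C⁆) =
      -trace (d Hp * (⁅d Hp, C⁆ * A) * ⁅d Hp, B⁆) := by
  rw [trace_mul_comm ((hB.mul_left A).mul_left (d Hp)) hC, ← mul_assoc, ← mul_assoc,
    lie_d_mul_d, ← trace_neg]
  noncomm_ring

lemma schwinger_lie_left {A B C : H →L[ℂ] H} (hA : IsHS ⁅d Hp, A⁆) (hB : IsHS ⁅d Hp, B⁆)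
    (hC : IsHS ⁅d Hp, C⁆) : schwinger Hp ⁅A, B⁆ C = -(1 / 2) *
      (trace (d Hp * (⁅d Hp, A⁆ * B) * ⁅d Hp, C⁆) + trace (d Hp * (A * ⁅d Hp, B⁆) * ⁅d Hp, C⁆) -
        trace (d Hp * (⁅d Hp, B⁆ * A) * ⁅d Hp, C⁆) -
        trace (d Hp * (B * ⁅d Hp, A⁆) * ⁅d Hp, C⁆)) := by
  have h1 : HasTrace (d Hp * (⁅d Hp, A⁆ * B) * ⁅d Hp, C⁆) :=
    ((hA.mul_right B).mul_left (d Hp)).hasTrace_mul hC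
  have h2 : HasTrace (d Hp * (A * ⁅d Hp, B⁆) * ⁅d Hp, C⁆) :=
    ((hB.mul_left A).mul_left (d Hp)).hasTrace_mul hC
  have h3 : HasTrace (-(d Hp * (⁅d Hp, B⁆ * A) * ⁅d Hp, C⁆)) :=
    (((hB.mul_right A).mul_left (d Hp)).hasTrace_mul hC).neg
  have h4 : HasTrace (-(d Hp * (B * ⁅d Hp, A⁆) * ⁅d Hp, C⁆)) :=
    (((hA.mul_left B).mul_left (d Hp)).hasTrace_mul hC).neg
  rw [schwinger_eq (isHS_lie_d_lie hA hB) hC, lie_d_lie]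
  simp only [mul_add, add_mul, mul_neg, neg_mul]
  rw [trace_add ((h1.add h2).add h3) h4, trace_add (h1.add h2) h3, trace_add h1 h2, trace_neg,
    trace_neg]
  ring

lemma schwinger_cocycle {A B C : H →L[ℂ] H} (hA : IsHS ⁅d Hp, A⁆) (hB : IsHS ⁅d Hp, B⁆)
    (hC : IsHS ⁅d Hp, C⁆) :
    schwinger Hp ⁅A, B⁆ C + schwinger Hp ⁅C, A⁆ B + schwinger Hp ⁅B, C⁆ A = 0 := by
  -- The twelve terms become six traces, each occurring twice with opposite signs.
  rw [schwinger_lie_left hA hB hC, schwinger_lie_left hC hA hB, schwinger_lie_left hB hC hA,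
    trace_d_mul_mul_mul A hB hC, trace_d_mul_mul_mul A hC hB, trace_d_mul_mul_mul B hA hC,
    trace_d_mul_mul_mul B hC hA, trace_d_mul_mul_mul C hA hB, trace_d_mul_mul_mul C hB hA]
  ring

/-! ### The algebra `L_{res,p}(H)` -/

lemma memRes_algebraMap {p : ℝ} (hp : 0 < p) (c : ℂ) :
    MemRes Hp p (algebraMap ℂ (H →L[ℂ] H) c) := by
  rw [MemRes, Ring.lie_def, ← Algebra.commutes, sub_self]
  exact memSchatten_zero hp

variable (Hp) in
/-- The algebra `L_{res,p}(H)`. -/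
def resAlgebra (p : ℝ) (hp : 0 < p) (hp2 : p ≤ 2) : Subalgebra ℂ (H →L[ℂ] H) where
  carrier := {A | MemRes Hp p A}
  mul_mem' {A B} hA hB := by
    change MemSchatten p ⁅d Hp, A * B⁆
    rw [lie_d_mul]
    exact MemSchatten.add hp hp2 (MemSchatten.mul_right hp hp2 hA B)
      (MemSchatten.mul_left hp hp2 hB A)
  add_mem' {A B} hA hB := by
    change MemSchatten p ⁅d Hp, A + B⁆
    rw [lie_d_add]
    exact MemSchatten.add hp hp2 hA hB
  algebraMap_mem' c := memRes_algebraMap hp c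

lemma MemRes.isHS {p : ℝ} (hp : 0 < p) (hp2 : p ≤ 2) {A : H →L[ℂ] H} (hA : MemRes Hp p A) :
    IsHS ⁅d Hp, A⁆ :=
  (isHS_and_sqrt_hsSq_le_schattenNorm hp hp2 hA).1

lemma MemRes.memOneQ {p q : ℝ} (hp : 0 < p) (hp2 : p ≤ 2) (hpq : p ≤ q) {A B : H →L[ℂ] H}
    (hA : MemRes Hp p A) (hB : MemRes Hp p B) : MemOneQ Hp q (A * ⁅d Hp, B⁆) := by
  have hA' := isHS_offDiag (MemRes.isHS hp hp2 hA)
  have hB' := MemRes.isHS hp hp2 hB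
  refine ⟨MemSchatten.mono hp hpq ?_, ?_, ?_⟩
  · have h := MemSchatten.mul_left hp hp2 hB A
    rw [Ring.lie_def, sub_eq_add_neg]
    refine MemSchatten.add hp hp2 (h.mul_left hp hp2 _) ?_
    simpa using (h.mul_right hp hp2 (d Hp)).smul hp hp2 (-1)
  · rw [blockPlus_mul_lie]
    exact memSchatten_compression _ hA' hB'
  · rw [blockMinus_mul_lie]
    exact memSchatten_compression _ hA' hB'

lemma schattenNorm_nonneg (p : ℝ) (A : H →L[ℂ] H) : 0 ≤ schattenNorm p A :=
  Real.rpow_nonneg ENNReal.toReal_nonneg _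

lemma resNorm_nonneg (p : ℝ) (A : H →L[ℂ] H) : 0 ≤ resNorm Hp p A :=
  add_nonneg (norm_nonneg _) (schattenNorm_nonneg _ _)

lemma norm_schwinger_le_resNorm {p : ℝ} (hp : 0 < p) (hp2 : p ≤ 2) {A B : H →L[ℂ] H}
    (hA : MemRes Hp p A) (hB : MemRes Hp p B) :
    ‖schwinger Hp A B‖ ≤ resNorm Hp p A * resNorm Hp p B := by
  have h : ∀ {C : H →L[ℂ] H}, MemRes Hp p C → √(hsSq ⁅d Hp, C⁆).toReal ≤ resNorm Hp p C :=
    fun hC => (isHS_and_sqrt_hsSq_le_schattenNorm hp hp2 hC).2.trans (le_add_of_nonneg_left (norm_nonneg _))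
  exact (norm_schwinger_le (hA.isHS hp hp2) (hB.isHS hp hp2)).trans
    (mul_le_mul (h hA) (h hB) (Real.sqrt_nonneg _) (resNorm_nonneg _ _))

end Polarized

/-- A bilinear map bounded for `N` is jointly continuous for `N`, whether or not `N` satisfies the
triangle inequality. -/
lemma jointly_continuous_of_bound {V : Type*} [AddCommGroup V] {N : V → ℝ} {Φ : V → V → ℂ}
    (hN : ∀ x, 0 ≤ N x) (add_left : ∀ x x' y, Φ (x + x') y = Φ x y + Φ x' y)
    (add_right : ∀ x y y', Φ x (y + y') = Φ x y + Φ x y')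
    (bound : ∀ x y, ‖Φ x y‖ ≤ N x * N y) (x y : V) (ε : ℝ) (hε : 0 < ε) :
    ∃ δ > 0, ∀ x' y', N (x' - x) < δ → N (y' - y) < δ → ‖Φ x' y' - Φ x y‖ < ε := by
  have hM : 0 < 1 + N x + N y := by linarith [hN x, hN y]
  -- Both increments are below `1`, so `a b + a N y + N x b ≤ max a b * (1 + N x + N y) < ε`.
  refine ⟨min 1 (ε / (1 + N x + N y)), by positivity, fun x' y' hx hy => ?_⟩
  have h : Φ x' y' - Φ x y = Φ (x' - x) (y' - y) + Φ (x' - x) y + Φ x (y' - y) := by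
    have h1 : Φ x' y' = Φ (x + (x' - x)) (y + (y' - y)) := by simp
    rw [h1, add_left, add_right, add_right]
    ring
  rw [lt_min_iff] at hx hy
  set a := N (x' - x)
  set b := N (y' - y)
  have ha : 0 ≤ a := hN _
  have hb : 0 ≤ b := hN _
  have hx2 := hx.2
  have hy2 := hy.2
  rw [lt_div_iff₀ hM] at hx2 hy2
  have h2 : ‖Φ x' y' - Φ x y‖ ≤ a * b + a * N y + N x * b := by
    rw [h]
    exact (norm_add₃_le).trans (add_le_add (add_le_add (bound _ _) (bound _ _)) (bound _ _))
  rcases le_total a b with hab | hab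
  · nlinarith [hN x, hN y, mul_nonneg hb (hN y), mul_nonneg ha hb]
  · nlinarith [hN x, hN y, mul_nonneg ha (hN x), mul_nonneg ha hb]

end RestrictedSchatten

end

/-! ### Assembly of the theorem -/

open RestrictedSchatten in
theorem mainTheorem9 {H : Type*} [NormedAddCommGroup H] [InnerProductSpace ℂ H] [CompleteSpace H]
    [TopologicalSpace.SeparableSpace H] (Hp : Submodule ℂ H) [CompleteSpace Hp]
    (hplus : ¬ FiniteDimensional ℂ Hp) (hminus : ¬ FiniteDimensional ℂ Hpᗮ)
    (p q : ℝ) (hp1 : 1 < p) (hp2 : p ≤ 2) (hpq : 1 / p + 1 / q = 1) :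
    -- `L_{res,p}(H)` is an algebra of operators, hence a Lie algebra under the commutator
    ∃ L : Subalgebra ℂ (H →L[ℂ] H),
      (∀ A : H →L[ℂ] H, A ∈ L ↔ RestrictedSchatten.MemRes Hp p A) ∧
      -- `A [d, B]` lies in `L_{1,q}(H)`, and its diagonal blocks have a trace that can be computed
      -- in every Hilbert basis
      (∀ A ∈ L, ∀ B ∈ L,
        RestrictedSchatten.MemOneQ Hp q (A * ⁅RestrictedSchatten.d Hp, B⁆) ∧
        (∀ e : HilbertBasis ℕ ℂ Hp,
          HasSum (fun n => ⟪e n, RestrictedSchatten.blockPlus Hp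
              (A * ⁅RestrictedSchatten.d Hp, B⁆) (e n)⟫_ℂ)
            (RestrictedSchatten.trace (RestrictedSchatten.blockPlus Hp
              (A * ⁅RestrictedSchatten.d Hp, B⁆)))) ∧
        (∀ f : HilbertBasis ℕ ℂ Hpᗮ,
          HasSum (fun n => ⟪f n, RestrictedSchatten.blockMinus Hp
              (A * ⁅RestrictedSchatten.d Hp, B⁆) (f n)⟫_ℂ)
            (RestrictedSchatten.trace (RestrictedSchatten.blockMinus Hp
              (A * ⁅RestrictedSchatten.d Hp, B⁆))))) ∧
      RestrictedSchatten.IsContinuousTwoCocycle (𝔤 := L)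
        (fun A => RestrictedSchatten.resNorm Hp p (A : H →L[ℂ] H))
        (fun A B => RestrictedSchatten.schwinger Hp (A : H →L[ℂ] H) (B : H →L[ℂ] H)) ∧
      (∀ A ∈ L, ∀ B ∈ L,
        ‖RestrictedSchatten.schwinger Hp A B‖ ≤
          2 * RestrictedSchatten.resNorm Hp p A * RestrictedSchatten.resNorm Hp p B) := by
  have hp : 0 < p := by linarith
  have hq : 0 < q := by
    by_contra hq
    have h1 : 1 / q ≤ 0 := one_div_nonpos.2 (not_lt.1 hq)
    have h2 : 1 / p < 1 := (div_lt_one hp).2 hp1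
    linarith
  -- `p ≤ 2` forces `p ≤ q`, so commutators in `L_p` also lie in `L_q`.
  have hpq' : p ≤ q := by
    have h1 : 1 / 2 ≤ 1 / p := one_div_le_one_div_of_le hp hp2
    have h2 : 1 / q ≤ 1 / p := by linarith
    exact (one_div_le_one_div hq hp).1 h2
  have hs : ∀ A : resAlgebra Hp p hp hp2, IsHS ⁅d Hp, (A : H →L[ℂ] H)⁆ :=
    fun A => MemRes.isHS hp hp2 A.2
  have hbound : ∀ A ∈ resAlgebra Hp p hp hp2, ∀ B ∈ resAlgebra Hp p hp hp2,
      ‖schwinger Hp A B‖ ≤ resNorm Hp p A * resNorm Hp p B :=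
    fun A hA B hB => norm_schwinger_le_resNorm hp hp2 hA hB
  have add_left : ∀ A A' B : resAlgebra Hp p hp hp2, schwinger Hp (A + A' : H →L[ℂ] H) B =
      schwinger Hp (A : H →L[ℂ] H) B + schwinger Hp (A' : H →L[ℂ] H) B :=
    fun A A' B => schwinger_add_left (hs A) (hs A') (hs B)
  have skew : ∀ A B : resAlgebra Hp p hp hp2, schwinger Hp (A : H →L[ℂ] H) B =
      -schwinger Hp (B : H →L[ℂ] H) A := fun A B => schwinger_skew (hs A) (hs B)
  have add_right : ∀ A B B' : resAlgebra Hp p hp hp2, schwinger Hp (A : H →L[ℂ] H) (B + B') =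
      schwinger Hp (A : H →L[ℂ] H) B + schwinger Hp (A : H →L[ℂ] H) B' := fun A B B' => by
    have h := skew A (B + B')
    rw [Subalgebra.coe_add, add_left] at h
    rw [h, neg_add, ← skew, ← skew]
  refine ⟨resAlgebra Hp p hp hp2, fun A => Iff.rfl, fun A hA B hB => ⟨?_, fun e => ?_, fun f => ?_⟩,
    ⟨add_left, fun c A B => schwinger_smul_left (hs A) (hs B) c, add_right, fun c A B => ?_, skew,
      fun A B C => schwinger_cocycle (hs A) (hs B) (hs C), ?_⟩, fun A hA B hB => ?_⟩
  · exact MemRes.memOneQ hp hp2 hpq' hA hB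
  · rw [blockPlus_mul_lie]
    exact hasSum_trace_compression _ (isHS_offDiag (hs ⟨A, hA⟩)) (hs ⟨B, hB⟩) e
  · rw [blockMinus_mul_lie]
    exact hasSum_trace_compression _ (isHS_offDiag (hs ⟨A, hA⟩)) (hs ⟨B, hB⟩) f
  · have h := skew A (c • B)
    rw [Subalgebra.coe_smul, schwinger_smul_left (hs B) (hs A) c] at h
    rw [Subalgebra.coe_smul, h, skew A B, mul_neg]
  · exact jointly_continuous_of_bound
      (Φ := fun A B : resAlgebra Hp p hp hp2 => schwinger Hp (A : H →L[ℂ] H) (B : H →L[ℂ] H))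
      (fun A => resNorm_nonneg p (A : H →L[ℂ] H)) add_left add_right
      fun A B => hbound A A.2 B B.2
  -- The bound already holds with constant `1`.
  · have h1 := hbound A hA B hB
    have h2 := mul_nonneg (resNorm_nonneg (Hp := Hp) p A) (resNorm_nonneg (Hp := Hp) p B)
    linarith
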